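/- Let $a=(a_n)_{n\ge 0}$ be a square-summable complex sequence with $a_n\neq a_{n+1}$ for all $n\ge 0$, and put $b_n:=1/(a_n-a_{n+1})$. Let $\mathcal J$ be the semi-infinite tridiagonal (Jacobi) matrix with $\mathcal J_{0,0}=b_0$, $\mathcal J_{n,n}=b_{n-1}+b_n$ for $n\ge1$, and $\mathcal J_{n,n+1}=\mathcal J_{n+1,n}=-b_n$ for $n\ge 0$. Let $J$ be the operator on $\ell^2(\mathbb N_0)$ acting by $Jx=\mathcal J\cdot x$ on the domain $\{x\in\ell^2(\mathbb N_0):\mathcal J\cdot x\in\ell^2(\mathbb N_0)\}$; it is injective. Let $L:=J^{-1}$ (with domain the range of $J$) be the regular $L$-operator with parameter sequence $a$. Further, let $p_n(z):=\det(z-J_n)$, where $J_n$ is the upper-left $n\times n$ section of $\mathcal J$; equivalently, $p_0(z)=1$, $p_1(z)=z-b_0$ and $p_{n+1}(z)=(z-b_{n-1}-b_n)p_n(z)-b_{n-1}^2p_{n-1}(z)$ for $n\ge1$. Suppose that $L$ is a trace class operator on $\ell^2(\mathbb N_0)$, i.e. $L$ is everywhere defined and bounded and $\operatorname{Tr}|L|<\infty$.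 Then, for all $z\in\mathbb C$, $$\det(1-zL)=\lim_{n\to\infty}(-1)^n\left[\prod_{j=1}^{n-1}(a_{j-1}-a_j)\right]\bigl(a_{n-1}p_n(z)+a_nb_{n-1}p_{n-1}(z)\bigr),$$ where $\det(1-zL)=\sum_{k\ge0}(-z)^k\operatorname{Tr}(\Lambda^kL)$ is the Fredholm determinant, $\Lambda^k L$ being the $k$-th exterior power of $L$. -/

import Mathlib

open scoped ENNReal
open Filter Topology

noncomputable section

namespace LMatrix

/-- The Hilbert space `ℓ²(ℕ₀)` of square summable complex sequences. -/
abbrev Ell2 : Type := lp (fun _ : ℕ => ℂ) 2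

/-- The standard basis vector `e_n` of `ℓ²(ℕ₀)`. -/
def stdVec (n : ℕ) : Ell2 := lp.single 2 n (1 : ℂ)

/-- The `L`-matrix with parameter sequence `a` has entries `a (max m n)`; it is regular when
consecutive parameters are distinct. -/
def IsRegularParam (a : ℕ → ℂ) : Prop := ∀ n, a n ≠ a (n + 1)

/-- `b_n = 1 / (a_n - a_{n+1})`. -/
def b (a : ℕ → ℂ) (n : ℕ) : ℂ := 1 / (a n - a (n + 1))

/-- The semi-infinite Jacobi matrix with diagonal `b_0, b_0 + b_1, b_1 + b_2, …` and both
off-diagonals equal to `-b_0, -b_1, …`. -/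
def jacobiMatrix (a : ℕ → ℂ) : Matrix ℕ ℕ ℂ := fun m n =>
  if m = n then (if n = 0 then b a 0 else b a (n - 1) + b a n)
  else if n = m + 1 then -b a m
  else if m = n + 1 then -b a n
  else 0

/-- Multiplication of a sequence, regarded as a column vector, by the Jacobi matrix. All entries of
row `n` in columns `k ≥ n + 2` vanish, so the sum over `k < n + 2` is the full row sum. -/
def jacobiMul (a : ℕ → ℂ) : (ℕ → ℂ) →ₗ[ℂ] (ℕ → ℂ) where
  toFun x n := ∑ k ∈ Finset.range (n + 2), jacobiMatrix a n k * x k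
  map_add' x y := by
    funext n
    simp [mul_add, Finset.sum_add_distrib]
  map_smul' c x := by
    funext n
    simp only [Pi.smul_apply, smul_eq_mul, RingHom.id_apply, Finset.mul_sum]
    exact Finset.sum_congr rfl fun k _ => by ring

/-- The Jacobi operator `J` on `ℓ²(ℕ₀)`: multiplication by the Jacobi matrix on the domain of all
`x ∈ ℓ²(ℕ₀)` for which the product is again in `ℓ²(ℕ₀)`. (The Jacobi matrix of a regular
`L`-matrix is proper: this maximal operator agrees with the minimal one, which is the closure of
the restriction to finitely supported sequences.) -/
def jacobiOperator (a : ℕ → ℂ) : Ell2 →ₗ.[ℂ] Ell2 where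
  domain :=
    { carrier := {x | Memℓp (jacobiMul a (x : ℕ → ℂ)) 2}
      zero_mem' := by
        have h : jacobiMul a ((0 : Ell2) : ℕ → ℂ) = 0 := by
          rw [lp.coeFn_zero, map_zero]
        simp only [Set.mem_ofPred_eq, h]
        exact zero_memℓp
      add_mem' := by
        intro x y hx hy
        simp only [Set.mem_ofPred_eq, lp.coeFn_add, map_add] at hx hy ⊢
        exact hx.add hy
      smul_mem' := by
        intro c x hx
        simp only [Set.mem_ofPred_eq, lp.coeFn_smul, map_smul] at hx ⊢
        exact hx.const_smul c }
  toFun :=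
    { toFun := fun x => ⟨jacobiMul a ((x : Ell2) : ℕ → ℂ), x.2⟩
      map_add' := by
        intro x y
        apply Subtype.ext
        exact map_add (jacobiMul a) ((x : Ell2) : ℕ → ℂ) ((y : Ell2) : ℕ → ℂ)
      map_smul' := by
        intro c x
        apply Subtype.ext
        exact map_smul (jacobiMul a) c ((x : Ell2) : ℕ → ℂ) }

/-- The Jacobi operator of a regular parameter sequence is injective, so that its inverse is a
genuine operator. -/
theorem jacobiOperator_ker (a : ℕ → ℂ) (hreg : IsRegularParam a) :
    LinearMap.ker (jacobiOperator a).toFun = ⊥ := by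
  rw [LinearMap.ker_eq_bot']
  intro x hx
  have hb : ∀ n, b a n ≠ 0 := fun n => by
    simp only [b]; exact one_div_ne_zero (sub_ne_zero.2 (hreg n))
  have h : ∀ n, jacobiMul a ((x : Ell2) : ℕ → ℂ) n = 0 := fun n => by
    have := congrArg (fun y : Ell2 => (y : ℕ → ℂ) n) hx
    exact this
  set f : ℕ → ℂ := ((x : Ell2) : ℕ → ℂ) with hf
  have step : ∀ n, f (n+1) = f n := by
    intro n
    induction n with
    | zero =>
      have := h 0
      simp [jacobiMul, jacobiMatrix, Finset.sum_range_succ] at this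
      have h2 : b a 0 * (f 0 - f 1) = 0 := by linear_combination this
      rcases mul_eq_zero.1 h2 with h3 | h3
      · exact absurd h3 (hb 0)
      · exact (sub_eq_zero.1 h3).symm
    | succ k ih =>
      have h1 := h (k+1)
      simp only [jacobiMul, LinearMap.coe_mk, AddHom.coe_mk] at h1
      rw [Finset.sum_range_succ, Finset.sum_range_succ, Finset.sum_range_succ, Finset.sum_eq_zero] at h1
      · have e1 : jacobiMatrix a (k+1) k = -b a k := by
          rw [jacobiMatrix, if_neg (by omega), if_neg (by omega), if_pos rfl]
        have e2 : jacobiMatrix a (k+1) (k+1) = b a k + b a (k+1) := by simp [jacobiMatrix]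
        have e3 : jacobiMatrix a (k+1) (k+2) = -b a (k+1) := by simp [jacobiMatrix]
        rw [e1, e2, e3] at h1
        have h2 : b a (k+1) * (f (k+1) - f (k+2)) = 0 := by linear_combination h1 - b a k * ih
        rcases mul_eq_zero.1 h2 with h3 | h3
        · exact absurd h3 (hb _)
        · exact (sub_eq_zero.1 h3).symm
      · intro i hi
        have := Finset.mem_range.1 hi
        rw [jacobiMatrix, if_neg (by omega), if_neg (by omega), if_neg (by omega), zero_mul]
  have const : ∀ n, f n = f 0 := fun n => by
    induction n with
    | zero => rfl
    | succ k ih => rw [step, ih]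
  have hs := (lp.memℓp (x : Ell2)).summable (by norm_num)
  have hz := hs.tendsto_atTop_zero
  have h0 : f 0 = 0 := by
    have : (fun n => ‖((x : Ell2) : ℕ → ℂ) n‖ ^ (2:ℝ≥0∞).toReal) = fun _ => ‖f 0‖ ^ (2:ℝ≥0∞).toReal := by
      funext n; rw [← hf, const]
    rw [this] at hz
    have := tendsto_nhds_unique tendsto_const_nhds hz
    simpa using this
  apply Subtype.ext
  apply lp.ext
  funext n
  show f n = 0
  rw [const, h0]
/-- The `L`-operator `L = J⁻¹` with parameter sequence `a`; its domain is the range of `J`. -/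
def lOperator (a : ℕ → ℂ) : Ell2 →ₗ.[ℂ] Ell2 := (jacobiOperator a).inverse

/-- The modulus `|A| = (A* A)^(1/2)` of a bounded operator on a complex Hilbert space. -/
def modulus {H : Type*} [NormedAddCommGroup H] [InnerProductSpace ℂ H] [CompleteSpace H]
    (A : H →L[ℂ] H) : H →L[ℂ] H := CFC.abs A

/-- A bounded operator `A` on `ℓ²(ℕ₀)` is of trace class if `Tr |A| = ∑ₙ ⟨eₙ, |A| eₙ⟩ < ∞`. -/
def IsTraceClass (A : Ell2 →L[ℂ] Ell2) : Prop :=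
  Summable fun n : ℕ => inner ℂ (stdVec n) (modulus A (stdVec n))

/-- The trace of the `k`-th exterior power `Λᵏ A` on `Λᵏ ℓ²(ℕ₀)`, in the orthonormal basis of the
vectors `e_S = e_{i₁} ∧ ⋯ ∧ e_{iₖ}`, `S = {i₁ < ⋯ < iₖ}`; the diagonal entry
`⟨e_S, Λᵏ(A) e_S⟩ = ⟨e_{i₁} ∧ ⋯ ∧ e_{iₖ}, A e_{i₁} ∧ ⋯ ∧ A e_{iₖ}⟩` is the determinant of the
matrix `(⟨e_i, A e_j⟩)` with `i, j ∈ S`. -/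
def traceExteriorPower (k : ℕ) (A : Ell2 →L[ℂ] Ell2) : ℂ :=
  ∑' S : {S : Finset ℕ // S.card = k},
    (Matrix.of fun i j : (S : Finset ℕ) => inner ℂ (stdVec i) (A (stdVec j))).det

/-- The Fredholm determinant `det (1 + A) = ∑ₖ Tr (Λᵏ A)` of a trace class operator `A`. -/
def fredholmDet (A : Ell2 →L[ℂ] Ell2) : ℂ := ∑' k : ℕ, traceExteriorPower k A

/-- The monic orthogonal polynomial `p_n(z) = det (z - J_n)`, where `J_n` is the `n × n` leading
section of the Jacobi matrix. -/
def orthoPoly (a : ℕ → ℂ) (n : ℕ) : Polynomial ℂ :=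
  ((jacobiMatrix a).submatrix (fun i : Fin n => (i : ℕ)) (fun i : Fin n => (i : ℕ))).charpoly

end LMatrix

end

/-! The entries of `L` are `a (max i j)`. Write `L_n`, `J_n` for the leading `n × n` sections, with
`n = m + 1`. The proof has an algebraic and an analytic half.

Algebra: replace the last row of `J_n` by `a_m` times itself minus `a_{m+1} b_m e_m`. The result `T`
factors as lower times upper bidiagonal, has determinant `∏_{i<m} b_i`, and satisfies `T L_n = C`
with `C = diag(1, …, 1, a_m)`. Hence `zC - T = -T (1 - z L_n)`. Expanding `det (zC - T)` along its
last row gives `a_m p_{m+1} + a_{m+1} b_m p_m`, so the sequence in the theorem is exactly `det (1 -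
z L_n)` (`det_one_sub_lSection`). There is no division by `a_m`, which may vanish.

Analysis: `det (1 - z L_n)` is the sum of the principal minors of `-zL` over `S ⊆ {0, …, n-1}`.
These minors are absolutely summable over all finite `S` (`IsTraceClass.summable_principalMinor`),
so the sections converge to the Fredholm determinant (`tendsto_det_section`). -/

/-! ### Hadamard-type bounds for determinants of inner products. -/

/-- Hadamard's inequality for the determinant in an orthonormal basis. -/
theorem OrthonormalBasis.norm_det_le {n : ℕ} {E : Type*} [NormedAddCommGroup E]
    [InnerProductSpace ℂ E] (e : OrthonormalBasis (Fin n) ℂ E) (w : Fin n → E) :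
    ‖e.toBasis.det w‖ ≤ ∏ i, ‖w i‖ := by
  have : FiniteDimensional ℂ E := e.toBasis.finiteDimensional_of_finite
  have h : Module.finrank ℂ E = Fintype.card (Fin n) := Module.finrank_eq_card_basis e.toBasis
  let g := InnerProductSpace.gramSchmidtOrthonormalBasis h w
  have h1 : e.toBasis.det w = e.toBasis.det g * g.toBasis.det w := by
    simp only [Module.Basis.det_apply]
    rw [← Matrix.det_mul, ← OrthonormalBasis.coe_toBasis g,
      Module.Basis.toMatrix_mul_toMatrix]
  rw [h1, norm_mul, OrthonormalBasis.det_to_matrix_orthonormalBasis, one_mul,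
    InnerProductSpace.gramSchmidtOrthonormalBasis_det, norm_prod]
  refine Finset.prod_le_prod (fun _ _ => norm_nonneg _) fun i _ => ?_
  simpa using norm_inner_le_norm (𝕜 := ℂ) (g i) (w i)

/-- Only the projections of the `u i` to the span of the `v j` matter. In an orthonormal basis of
that span the matrix is `U* V`, and Hadamard's inequality bounds each factor. Dependent `v j` give
dependent columns. -/
theorem Matrix.norm_det_inner_le_fin {n : ℕ} {H : Type*} [NormedAddCommGroup H]
    [InnerProductSpace ℂ H] (u v : Fin n → H) :
    ‖(Matrix.of fun i j => inner ℂ (u i) (v j)).det‖ ≤ ∏ i, ‖u i‖ * ‖v i‖ := by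
  by_cases hv : LinearIndependent ℂ v
  · let F := Submodule.span ℂ (Set.range v)
    have hF : Module.finrank ℂ F = n := by
      rw [finrank_span_eq_card hv, Fintype.card_fin]
    have : FiniteDimensional ℂ F := FiniteDimensional.span_of_finite ℂ (Set.finite_range v)
    let e : OrthonormalBasis (Fin n) ℂ F := (stdOrthonormalBasis ℂ F).reindex (finCongr hF)
    let v' : Fin n → F := fun j => ⟨v j, Submodule.subset_span ⟨j, rfl⟩⟩
    let u' : Fin n → F := fun i => F.orthogonalProjectionOnto (u i)
    have hM : (Matrix.of fun i j => inner ℂ (u i) (v j)) =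
        (e.toBasis.toMatrix u').conjTranspose * e.toBasis.toMatrix v' := by
      ext i j
      have h1 : inner ℂ (u i) (v j) = inner ℂ (u' i) (v' j) :=
        (Submodule.inner_orthogonalProjectionOnto_eq_of_mem_right (v' j) (u i)).symm
      rw [Matrix.of_apply, h1, ← e.sum_inner_mul_inner, Matrix.mul_apply]
      refine Finset.sum_congr rfl fun k _ => ?_
      simp [Module.Basis.toMatrix_apply, OrthonormalBasis.repr_apply_apply]
    rw [hM, Matrix.det_mul, Matrix.det_conjTranspose, norm_mul, norm_star,
      Finset.prod_mul_distrib]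
    refine mul_le_mul ((e.norm_det_le u').trans ?_) (e.norm_det_le v') (norm_nonneg _)
      (Finset.prod_nonneg fun _ _ => norm_nonneg _)
    refine Finset.prod_le_prod (fun _ _ => norm_nonneg _) fun i _ => ?_
    exact F.norm_orthogonalProjectionOnto_apply_le (u i)
  · obtain ⟨c, hc, i, hi⟩ := Fintype.not_linearIndependent_iff.1 hv
    have : (Matrix.of fun i j => inner ℂ (u i) (v j)).det = 0 := by
      refine Matrix.exists_mulVec_eq_zero_iff.1 ⟨c, fun h => hi (by rw [h]; rfl), ?_⟩
      ext k
      have := congrArg (inner ℂ (u k)) hc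
      simpa [Matrix.mulVec, dotProduct, inner_sum, inner_smul_right, mul_comm] using this
    rw [this, norm_zero]
    positivity

theorem Matrix.norm_det_inner_le {ι : Type*} [Fintype ι] [DecidableEq ι] {H : Type*}
    [NormedAddCommGroup H] [InnerProductSpace ℂ H] (u v : ι → H) :
    ‖(Matrix.of fun i j => inner ℂ (u i) (v j)).det‖ ≤ ∏ i, ‖u i‖ * ‖v i‖ := by
  let e := (Fintype.equivFin ι).symm
  have := Matrix.norm_det_inner_le_fin (u ∘ e) (v ∘ e)
  rw [← Matrix.det_submatrix_equiv_self e, ← e.prod_comp]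
  exact this

/-! ### Polar decomposition and factorization of trace class operators. -/

namespace LMatrix

variable {H : Type*} [NormedAddCommGroup H] [InnerProductSpace ℂ H] [CompleteSpace H]

theorem norm_modulus_apply (A : H →L[ℂ] H) (x : H) : ‖modulus A x‖ = ‖A x‖ := by
  have hsa : star (modulus A) = modulus A := (IsSelfAdjoint.of_nonneg (CFC.abs_nonneg A))
  have h : star (modulus A) * modulus A = star A * A := by
    rw [hsa]; exact CFC.abs_mul_abs A
  have h1 : (inner ℂ (modulus A x) (modulus A x) : ℂ) = inner ℂ (A x) (A x) := by
    have := congrArg (fun T : H →L[ℂ] H => inner ℂ x (T x)) h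
    simpa [ContinuousLinearMap.star_eq_adjoint, ContinuousLinearMap.adjoint_inner_right]
      using this
  rw [inner_self_eq_norm_sq_to_K, inner_self_eq_norm_sq_to_K] at h1
  have h2 : ‖modulus A x‖ ^ 2 = ‖A x‖ ^ 2 := by exact_mod_cast h1
  exact (sq_eq_sq₀ (norm_nonneg _) (norm_nonneg _)).1 h2

/-- A weak polar decomposition: `A = U |A|` with a contraction `U`. -/
theorem exists_contraction_mul_modulus (A : H →L[ℂ] H) :
    ∃ U : H →L[ℂ] H, (∀ x, ‖U x‖ ≤ ‖x‖) ∧ ∀ x, U (modulus A x) = A x := by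
  let K : Submodule ℂ H := (LinearMap.range (modulus A : H →ₗ[ℂ] H)).topologicalClosure
  have hK : IsClosed (K : Set H) := Submodule.isClosed_topologicalClosure _
  have : CompleteSpace K := hK.completeSpace_coe
  have hmem : ∀ x, (modulus A : H →ₗ[ℂ] H) x ∈ K := fun x =>
    Submodule.le_topologicalClosure _ (LinearMap.mem_range_self _ x)
  let e : H →ₗ[ℂ] K := (modulus A : H →ₗ[ℂ] H).codRestrict K hmem
  have hd : DenseRange e := by
    intro y
    rw [closure_subtype]
    have : (y : H) ∈ closure (Set.range (modulus A : H →ₗ[ℂ] H)) := y.2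
    convert this using 2
    rw [← Set.range_comp]
    rfl
  have hn : ∀ x, ‖(A : H →ₗ[ℂ] H) x‖ ≤ 1 * ‖e x‖ := fun x => by
    rw [one_mul]; exact (norm_modulus_apply A x).ge
  -- Since `‖A x‖ = ‖|A| x‖`, the assignment `|A| x ↦ A x` extends to the closed range `K`;
  -- composing with the projection onto `K` makes it zero on the complement.
  let V := (A : H →ₗ[ℂ] H).extendOfNorm e
  refine ⟨V ∘L K.orthogonalProjectionOnto, fun x => ?_, fun x => ?_⟩
  · have := LinearMap.norm_extendOfNorm_apply_le hd 1 hn (K.orthogonalProjectionOnto x)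
    rw [one_mul] at this
    exact this.trans (K.norm_orthogonalProjectionOnto_apply_le x)
  · have h1 : K.orthogonalProjectionOnto (modulus A x) = e x :=
      Submodule.orthogonalProjectionOnto_mem_subspace_eq_self (e x)
    rw [ContinuousLinearMap.comp_apply, h1]
    exact LinearMap.extendOfNorm_eq hd ⟨1, hn⟩ x

theorem inner_stdVec (n : ℕ) (x : Ell2) : inner ℂ (stdVec n) x = x n := by
  rw [stdVec, lp.inner_single_left]; simp

theorem norm_sq_eq_tsum (x : Ell2) :
    ENNReal.ofReal (‖x‖ ^ 2) = ∑' n, ENNReal.ofReal (‖x n‖ ^ 2) := by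
  have h1 := lp.hasSum_norm (p := 2) (by norm_num) x
  norm_num at h1
  rw [← h1.tsum_eq, ENNReal.ofReal_tsum_of_nonneg (fun _ => by positivity) h1.summable]

/-- Both sides sum the squared moduli of all matrix entries; in `ℝ≥0∞` the order of summation can be
exchanged unconditionally. -/
theorem tsum_norm_sq_adjoint (B : Ell2 →L[ℂ] Ell2) :
    ∑' n, ENNReal.ofReal (‖ContinuousLinearMap.adjoint B (stdVec n)‖ ^ 2) =
      ∑' n, ENNReal.ofReal (‖B (stdVec n)‖ ^ 2) := by
  simp only [norm_sq_eq_tsum]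
  rw [ENNReal.tsum_comm]
  refine tsum_congr fun m => tsum_congr fun n => ?_
  rw [← inner_stdVec, ← inner_stdVec, ContinuousLinearMap.adjoint_inner_right,
    norm_inner_symm]

theorem summable_norm_sq_adjoint (B : Ell2 →L[ℂ] Ell2)
    (hB : Summable fun n => ‖B (stdVec n)‖ ^ 2) :
    Summable fun n => ‖ContinuousLinearMap.adjoint B (stdVec n)‖ ^ 2 := by
  have h1 := hB.tsum_ofReal_ne_top
  rw [← tsum_norm_sq_adjoint] at h1
  have := ENNReal.summable_toReal h1
  simpa [ENNReal.toReal_ofReal, sq_nonneg] using this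

/-- Every bounded operator is a product `A = B C` with `C = |A|^(1/2)` and `B` dominated by `C`. -/
theorem exists_factorization (A : H →L[ℂ] H) :
    ∃ B C : H →L[ℂ] H, (∀ x, B (C x) = A x) ∧ (∀ x, ‖B x‖ ≤ ‖C x‖) ∧
      ∀ x, inner ℂ x (modulus A x) = ((‖C x‖ ^ 2 : ℝ) : ℂ) := by
  have h0 : 0 ≤ modulus A := CFC.abs_nonneg A
  obtain ⟨U, hU, hUA⟩ := exists_contraction_mul_modulus A
  let C := CFC.sqrt (modulus A)
  have hC : C * C = modulus A := CFC.sqrt_mul_sqrt_self _ h0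
  have hsa : ContinuousLinearMap.adjoint C = C :=
    IsSelfAdjoint.of_nonneg (CFC.sqrt_nonneg (modulus A))
  have hCC : ∀ x, C (C x) = modulus A x := fun x => by rw [← hC]; rfl
  refine ⟨U ∘L C, C, fun x => ?_, fun x => hU _, fun x => ?_⟩
  · rw [ContinuousLinearMap.comp_apply, hCC, hUA]
  · rw [← hCC, ← ContinuousLinearMap.adjoint_inner_left, hsa, inner_self_eq_norm_sq_to_K]
    norm_num

/-- The matrix entries of a trace class operator are the inner products of two square summable
families of vectors. -/
theorem IsTraceClass.exists_inner_eq {A : Ell2 →L[ℂ] Ell2} (hA : IsTraceClass A) :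
    ∃ u v : ℕ → Ell2, (∀ i j, inner ℂ (stdVec i) (A (stdVec j)) = inner ℂ (u i) (v j)) ∧
      Summable (fun i => ‖u i‖ ^ 2) ∧ Summable (fun i => ‖v i‖ ^ 2) := by
  obtain ⟨B, C, hBC, hle, hn⟩ := exists_factorization A
  have hs : Summable fun n => ‖C (stdVec n)‖ ^ 2 := by
    have h1 : Summable fun n => ((‖C (stdVec n)‖ ^ 2 : ℝ) : ℂ) := by
      simpa only [IsTraceClass, hn] using hA
    exact Complex.summable_ofReal.1 h1
  refine ⟨fun i => ContinuousLinearMap.adjoint B (stdVec i), fun j => C (stdVec j),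
    fun i j => ?_, summable_norm_sq_adjoint _ ?_, hs⟩
  · rw [ContinuousLinearMap.adjoint_inner_left, hBC]
  · refine hs.of_nonneg_of_le (fun _ => by positivity) fun n => ?_
    gcongr
    exact hle _

/-! ### Principal minors and the Fredholm determinant. -/

/-- The principal minor of the matrix of `A` with index set `S`. -/
noncomputable def principalMinor (A : Ell2 →L[ℂ] Ell2) (S : Finset ℕ) : ℂ :=
  (Matrix.of fun i j : S => inner ℂ (stdVec i) (A (stdVec j))).det

/-- The minor over `S` is at most `∏_{i ∈ S} r_i` with `r_i = ‖c‖ ‖u i‖ ‖v i‖`. As `∑ r_i < ∞`,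
these products are summable over finite sets: they are the terms in the expansion of `∏ (1 + r_i)`.
-/
theorem IsTraceClass.summable_principalMinor {A : Ell2 →L[ℂ] Ell2} (hA : IsTraceClass A)
    (c : ℂ) : Summable (principalMinor (c • A)) := by
  obtain ⟨u, v, huv, hu, hv⟩ := hA.exists_inner_eq
  have hr : Summable fun i => ‖c‖ * (‖u i‖ * ‖v i‖) := by
    refine Summable.mul_left _ ((hu.add hv).of_nonneg_of_le (fun _ => by positivity) fun i => ?_)
    nlinarith [sq_nonneg (‖u i‖ - ‖v i‖), sq_nonneg ‖u i‖, sq_nonneg ‖v i‖]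
  refine (summable_finsetProd_of_summable_nonneg (fun _ => by positivity) hr).of_norm_bounded
    fun S => ?_
  have h1 := Matrix.norm_det_inner_le (fun i : S => u i) (fun j : S => c • v j)
  rw [← Finset.prod_coe_sort]
  have h2 : principalMinor (c • A) S =
      (Matrix.of fun i j : S => inner ℂ (u i) (c • v j)).det := by
    simp only [principalMinor, smul_apply, inner_smul_right, huv]
  rw [h2]
  refine h1.trans (le_of_eq (Finset.prod_congr rfl fun i _ => ?_))
  rw [norm_smul]; ring

theorem tsum_tsum_fiber {ι κ : Type*} {f : ι → ℂ} (hf : Summable f) (g : ι → κ) :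
    ∑' k, ∑' i : {i // g i = k}, f i = ∑' i, f i := by
  have h1 := (Equiv.sigmaFiberEquiv g).tsum_eq f
  have hs : Summable fun p => f (Equiv.sigmaFiberEquiv g p) :=
    (Equiv.sigmaFiberEquiv g).summable_iff.2 hf
  rw [← h1, hs.tsum_sigma]
  rfl

/-- Summability over all finite sets allows grouping by cardinality, and excludes the default value
`0` of the sums. -/
theorem fredholmDet_eq_tsum {A : Ell2 →L[ℂ] Ell2} (h : Summable (principalMinor A)) :
    fredholmDet A = ∑' S, principalMinor A S := by
  rw [← tsum_tsum_fiber h Finset.card, fredholmDet]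
  rfl

end LMatrix

/-- `det (1 + A)` is the sum of all principal minors of `A`. -/
theorem Matrix.det_one_add_eq_sum_minors {n R : Type*} [Fintype n] [DecidableEq n] [CommRing R]
    (A : Matrix n n R) :
    (1 + A).det = ∑ s : Finset n, (A.submatrix (Subtype.val : s → n) Subtype.val).det := by
  rw [add_comm]
  rw [show (A + 1).det = _ from
    (Matrix.detRowAlternating (n := n) (R := R)).map_add_univ (fun i => A i)
      (fun i => (1 : Matrix n n R) i)]
  refine Finset.sum_congr rfl fun s _ => ?_
  -- Multilinearity chooses each row from `A` or from `1`. Rows outside `s` are unit vectors, so the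
  -- matrix is block triangular and only the minor over `s` survives.
  let M : Matrix n n R := Matrix.of fun i j => if i ∈ s then A i j else (1 : Matrix n n R) i j
  have hM : Matrix.detRowAlternating (s.piecewise (fun i => A i) fun i => (1 : Matrix n n R) i) =
      M.det := by
    change Matrix.detRowAlternating _ = Matrix.detRowAlternating _
    congr 1
    ext i j
    by_cases hi : i ∈ s <;> simp [M, Finset.piecewise, hi]
  rw [hM, Matrix.twoBlockTriangular_det _ (· ∈ s)]
  · have h1 : Matrix.toSquareBlockProp M (· ∈ s) =
        A.submatrix (Subtype.val : s → n) Subtype.val := by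
      ext i j
      exact if_pos i.2
    have h2 : Matrix.toSquareBlockProp M (¬ · ∈ s) = 1 := by
      ext i j
      refine (if_neg i.2).trans ?_
      simp only [Matrix.one_apply, Subtype.ext_iff]
    rw [h1, h2, Matrix.det_one, mul_one]
    congr!
  · intro i hi j hj
    exact (if_neg hi).trans (Matrix.one_apply_ne fun h => hi (h ▸ hj))

namespace LMatrix

theorem det_one_add_section (A : Ell2 →L[ℂ] Ell2) (n : ℕ) :
    (1 + Matrix.of fun i j : Fin n => inner ℂ (stdVec i) (A (stdVec j))).det =
      ∑ S ∈ (Finset.range n).powerset, principalMinor A S := by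
  rw [Matrix.det_one_add_eq_sum_minors]
  refine Finset.sum_bij (fun s _ => s.map Fin.valEmbedding) (fun s _ => ?_)
    (fun s _ t _ h => Finset.map_injective _ h) (fun S hS => ?_) (fun s _ => ?_)
  · rw [Finset.mem_powerset]
    intro i hi
    obtain ⟨j, _, rfl⟩ := Finset.mem_map.1 hi
    exact Finset.mem_range.2 j.2
  · refine ⟨S.attachFin fun i hi => Finset.mem_range.1 (Finset.mem_powerset.1 hS hi),
      Finset.mem_univ _, ?_⟩
    exact Finset.map_valEmbedding_attachFin _
  · let e : s ≃ s.map Fin.valEmbedding := Equiv.ofBijective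
      (fun i => ⟨i, Finset.mem_map_of_mem Fin.valEmbedding i.2⟩)
      ⟨fun i j h => Subtype.ext (Fin.ext (congrArg Subtype.val h)), fun j => by
        obtain ⟨i, hi, h⟩ := Finset.mem_map.1 j.2
        exact ⟨⟨i, hi⟩, Subtype.ext h⟩⟩
    rw [principalMinor, ← Matrix.det_submatrix_equiv_self e]
    rfl

/-- The determinants of the finite sections of `1 + A` converge to the Fredholm determinant. -/
theorem tendsto_det_section {A : Ell2 →L[ℂ] Ell2} (h : Summable (principalMinor A)) :
    Tendsto (fun n : ℕ => (1 + Matrix.of fun i j : Fin n =>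
      inner ℂ (stdVec i) (A (stdVec j))).det) atTop (𝓝 (fredholmDet A)) := by
  simp only [det_one_add_section]
  rw [fredholmDet_eq_tsum h]
  -- The families of all subsets of `range n` are cofinal among the finite families of finite sets.
  exact h.hasSum.comp (tendsto_finset_powerset_atTop_atTop.comp tendsto_finset_range)

/-! ### The determinant identity for finite sections. -/

/-- The `n × n` leading section of the `L`-matrix. -/
noncomputable def lSection (a : ℕ → ℂ) (n : ℕ) : Matrix (Fin n) (Fin n) ℂ :=
  Matrix.of fun i j => a (max (i : ℕ) j)

/-- The leading section of the Jacobi matrix. -/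
noncomputable def jacobiSection (a : ℕ → ℂ) (n : ℕ) : Matrix (Fin n) (Fin n) ℂ :=
  (jacobiMatrix a).submatrix (fun i : Fin n => (i : ℕ)) (fun i : Fin n => (i : ℕ))

/-- The upper bidiagonal matrix of the difference operator `x ↦ (x_i - x_{i+1})_i`. -/
noncomputable def diffMatrix (m : ℕ) : Matrix (Fin (m + 1)) (Fin (m + 1)) ℂ :=
  Matrix.of fun i j => (if i = j then 1 else 0) - if (j : ℕ) = i + 1 then 1 else 0

/-- The diagonal matrix `diag (1, …, 1, a_m)`. -/
noncomputable def cornerMatrix (a : ℕ → ℂ) (m : ℕ) : Matrix (Fin (m + 1)) (Fin (m + 1)) ℂ :=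
  Matrix.of fun i j => if i = j then (if (i : ℕ) = m then a m else 1) else 0

/-- The lower bidiagonal matrix whose product with `diffMatrix` is the Jacobi section with a
modified last row. -/
noncomputable def lowerFactor (a : ℕ → ℂ) (m : ℕ) : Matrix (Fin (m + 1)) (Fin (m + 1)) ℂ :=
  Matrix.of fun i j => (if i = j then (if (i : ℕ) = m then 1 else b a i) else 0) -
    if (i : ℕ) = j + 1 then (if (i : ℕ) = m then a m else 1) * b a j else 0

variable (a : ℕ → ℂ) (m : ℕ)

theorem diffMatrix_mul_last (M : Matrix (Fin (m + 1)) (Fin (m + 1)) ℂ) (j : Fin (m + 1)) :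
    (diffMatrix m * M) (Fin.last m) j = M (Fin.last m) j := by
  rw [Matrix.mul_apply, Finset.sum_eq_single (Fin.last m)]
  · simp [diffMatrix]
  · intro k _ hk
    have h2 : (k : ℕ) ≠ m + 1 := by omega
    simp [diffMatrix, hk.symm, h2]
  · simp

theorem diffMatrix_mul_castSucc (M : Matrix (Fin (m + 1)) (Fin (m + 1)) ℂ) (i : Fin m)
    (j : Fin (m + 1)) : (diffMatrix m * M) i.castSucc j = M i.castSucc j - M i.succ j := by
  have h (k : Fin (m + 1)) : ((k : ℕ) = i + 1) ↔ (i.succ = k) := by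
    rw [Fin.ext_iff, Fin.val_succ, eq_comm]
  simp [Matrix.mul_apply, diffMatrix, sub_mul, Finset.sum_sub_distrib, h]

theorem lowerFactor_mul_zero (M : Matrix (Fin (m + 1)) (Fin (m + 1)) ℂ) (j : Fin (m + 1)) :
    (lowerFactor a m * M) 0 j = (if 0 = m then 1 else b a 0) * M 0 j := by
  rcases m with _ | m
  · simp [Matrix.mul_apply, lowerFactor]
  · simp [Matrix.mul_apply, lowerFactor]

theorem lowerFactor_mul_succ (M : Matrix (Fin (m + 1)) (Fin (m + 1)) ℂ) (i : Fin m)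
    (j : Fin (m + 1)) : (lowerFactor a m * M) i.succ j =
      (if (i : ℕ) + 1 = m then 1 else b a (i + 1)) * M i.succ j -
        (if (i : ℕ) + 1 = m then a m else 1) * b a i * M i.castSucc j := by
  have h (k : Fin (m + 1)) : ((i : ℕ) = k) ↔ (i.castSucc = k) := by
    rw [Fin.ext_iff, Fin.val_castSucc]
  simp only [Matrix.mul_apply, lowerFactor, Matrix.of_apply, sub_mul, Finset.sum_sub_distrib,
    ite_mul, zero_mul, Finset.sum_ite_eq, Finset.mem_univ, if_true, Fin.val_succ,
    add_left_inj, h]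
  simp

variable {a} in
theorem sub_mul_b (ha : IsRegularParam a) (n : ℕ) : (a n - a (n + 1)) * b a n = 1 := by
  rw [b, mul_one_div, div_self (sub_ne_zero.2 (ha n))]

/-- Right of the diagonal, `a (max i j)` does not depend on `i`, so row differences vanish there. -/
theorem diffMatrix_mul_lSection (i j : Fin (m + 1)) :
    (diffMatrix m * lSection a (m + 1)) i j =
      if j ≤ i then (if (i : ℕ) = m then a m else a i - a (i + 1)) else 0 := by
  induction i using Fin.lastCases with
  | last =>
    rw [diffMatrix_mul_last]
    simp [lSection, Fin.le_last, Nat.max_eq_left (Nat.le_of_lt_succ j.2)]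
  | cast i =>
    rw [diffMatrix_mul_castSucc]
    have hi : (i : ℕ) ≠ m := i.2.ne
    simp only [lSection, Matrix.of_apply, Fin.le_def, Fin.val_castSucc, Fin.val_succ, hi, if_false]
    split_ifs with h
    · rw [Nat.max_eq_left h, Nat.max_eq_left (by omega)]
    · rw [Nat.max_eq_right (by omega), Nat.max_eq_right (by omega), sub_self]

/-- Scaling row `i < m` of the triangular product by `b_i` makes it the indicator of `j ≤ i`;
subtracting the previous indicator leaves `e_i`. The last row is already `a_m` times an indicator,
so `a_m` times the previous one is subtracted. -/
theorem lowerFactor_mul_diffMatrix_mul_lSection (ha : IsRegularParam a) :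
    lowerFactor a m * (diffMatrix m * lSection a (m + 1)) = cornerMatrix a m := by
  ext i j
  induction i using Fin.cases with
  | zero =>
    rw [lowerFactor_mul_zero, diffMatrix_mul_lSection]
    have h0 := sub_mul_b ha 0
    simp only [cornerMatrix, Matrix.of_apply, Fin.le_def, Fin.ext_iff, Fin.val_zero]
    by_cases hj : (j : ℕ) = 0
    · by_cases hm : 0 = m
      · simp [hj, hm]
      · simp only [hj, hm, if_true, if_false, le_refl]
        linear_combination h0
    · simp [hj, Ne.symm hj]
  | succ i =>
    rw [lowerFactor_mul_succ, diffMatrix_mul_lSection, diffMatrix_mul_lSection]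
    have h1 := sub_mul_b ha i
    have h2 := sub_mul_b ha (i + 1)
    have := i.2
    simp only [cornerMatrix, Matrix.of_apply, Fin.le_def, Fin.ext_iff, Fin.val_succ,
      Fin.val_castSucc]
    split_ifs <;> first
      | omega
      | ring1
      | linear_combination h2 - h1
      | linear_combination -a m * h1
      | linear_combination h2

/-- The modified characteristic matrix of the Jacobi section. -/
theorem updateRow_eq (ha : IsRegularParam a) (z : ℂ) :
    (Matrix.scalar (Fin (m + 1)) z - jacobiSection a (m + 1)).updateRow (Fin.last m)
      (a m • (Matrix.scalar (Fin (m + 1)) z - jacobiSection a (m + 1)) (Fin.last m) +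
        (a (m + 1) * b a m) • Pi.single (Fin.last m) 1) =
      z • cornerMatrix a m - lowerFactor a m * diffMatrix m := by
  -- This turns the corner entry `a_m (b_{m-1} + b_m) - a_{m+1} b_m` into `a_m b_{m-1} + 1`.
  have hm := sub_mul_b ha m
  ext i j
  have hj := j.2
  induction i using Fin.cases with
  | zero =>
    simp only [Matrix.sub_apply, lowerFactor_mul_zero, Matrix.updateRow_apply, cornerMatrix,
      jacobiSection, Matrix.submatrix_apply, jacobiMatrix, diffMatrix, Matrix.of_apply,
      Matrix.smul_apply, smul_eq_mul, Pi.add_apply, Pi.smul_apply, Pi.single_apply,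
      Matrix.scalar_apply, Matrix.diagonal_apply, Fin.ext_iff, Fin.val_zero, Fin.val_last]
    rcases Nat.eq_zero_or_pos m with rfl | h
    · have : (j : ℕ) = 0 := by omega
      simp
      linear_combination -hm
    · by_cases h1 : (j : ℕ) = 0
      · simp [h1, h.ne]
      · by_cases h2 : (j : ℕ) = 1
        · simp [h2, h.ne]
        · simp [h1, h2, h.ne, Ne.symm h1]
  | succ i =>
    simp only [Matrix.sub_apply, lowerFactor_mul_succ, Matrix.updateRow_apply, cornerMatrix,
      jacobiSection, Matrix.submatrix_apply, jacobiMatrix, diffMatrix, Matrix.of_apply,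
      Matrix.smul_apply, smul_eq_mul, Pi.add_apply, Pi.smul_apply, Pi.single_apply,
      Matrix.scalar_apply, Matrix.diagonal_apply, Fin.ext_iff, Fin.val_succ, Fin.val_castSucc,
      Fin.val_last]
    by_cases h : (i : ℕ) + 1 = m
    · have hm' : m ≠ 0 := by omega
      have hm1 : m - 1 = i := by omega
      have h0 : (i : ℕ) ≠ m := by omega
      have h0' : m ≠ i := h0.symm
      by_cases h1 : (j : ℕ) = i + 1
      · simp [h1, h, h0, hm', hm1]
        linear_combination -hm
      · by_cases h2 : (j : ℕ) = i
        · have h6 : (i : ℕ) ≠ m + 1 := by omega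
          simp [h2, h, h0, h0', h6]
        · have h3 : ¬ (i : ℕ) + 1 = j := fun h => h1 h.symm
          have h4 : ¬ (i : ℕ) = j := fun h => h2 h.symm
          have h5 : ¬ (j : ℕ) = i + 1 + 1 := by omega
          have h6 : ¬ (m : ℕ) = j + 1 := by omega
          rw [h] at h1 h3 h5
          simp [h, h1, h3, h4, h5, h6]
    · by_cases h1 : (j : ℕ) = i + 1
      · simp [h, h1]
        ring
      · by_cases h2 : (j : ℕ) = i
        · have h6 : ¬ (i : ℕ) = i + 1 + 1 := by omega
          simp [h, h2, h6]
        · have h3 : ¬ (i : ℕ) + 1 = j := fun h => h1 h.symm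
          have h4 : ¬ (i : ℕ) = j := fun h => h2 h.symm
          by_cases h5 : (j : ℕ) = i + 1 + 1
          · have h6 : ¬ (i : ℕ) = i + 1 + 1 := by omega
            simp [h, h5, h6]
          · simp [h, h1, h3, h4, h5]

theorem det_diffMatrix : (diffMatrix m).det = 1 := by
  rw [Matrix.det_of_isUpperTriangular]
  · simp [diffMatrix]
  · intro i j h
    have h' : (j : ℕ) < i := h
    have h1 : i ≠ j := fun h => by simp [h] at h'
    have h2 : (j : ℕ) ≠ i + 1 := by omega
    simp [diffMatrix, h1, h2]

theorem det_lowerFactor : (lowerFactor a m).det = ∏ i ∈ Finset.range m, b a i := by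
  rw [Matrix.det_of_isLowerTriangular]
  · rw [Fin.prod_univ_castSucc, Finset.prod_range]
    have (i : Fin m) : (i : ℕ) ≠ m := i.2.ne
    simp [lowerFactor, this]
  · intro i j h
    have h' : (i : ℕ) < j := h
    have h1 : i ≠ j := fun h => by simp [h] at h'
    have h2 : (i : ℕ) ≠ j + 1 := by omega
    simp [lowerFactor, h1, h2]

theorem eval_orthoPoly (n : ℕ) (z : ℂ) :
    (orthoPoly a n).eval z = (Matrix.scalar (Fin n) z - jacobiSection a n).det := by
  rw [orthoPoly, Matrix.eval_charpoly]
  rfl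

/-- The determinant is linear in the last row, and the cofactor of the corner is the preceding
characteristic polynomial. -/
theorem det_updateRow_jacobiSection (z x y : ℂ) :
    ((Matrix.scalar (Fin (m + 1)) z - jacobiSection a (m + 1)).updateRow (Fin.last m)
      (x • (Matrix.scalar (Fin (m + 1)) z - jacobiSection a (m + 1)) (Fin.last m) +
        y • Pi.single (Fin.last m) 1)).det =
      x * (orthoPoly a (m + 1)).eval z + y * (orthoPoly a m).eval z := by
  rw [Matrix.det_updateRow_add, Matrix.det_updateRow_smul, Matrix.det_updateRow_smul,
    Matrix.updateRow_eq_self, ← Matrix.adjugate_apply, Matrix.adjugate_fin_succ_eq_det_submatrix,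
    eval_orthoPoly, eval_orthoPoly, ← two_mul, pow_mul, neg_one_sq, one_pow, one_mul]
  congr 3
  ext i j
  simp [jacobiSection, Matrix.diagonal_apply]

/-- The determinant of a section of `1 - z L` in terms of the orthogonal polynomials. -/
theorem det_one_sub_lSection (ha : IsRegularParam a) (z : ℂ) :
    (-1 : ℂ) ^ (m + 1) * (∏ j ∈ Finset.range m, (a j - a (j + 1))) *
      (a m * (orthoPoly a (m + 1)).eval z + a (m + 1) * b a m * (orthoPoly a m).eval z) =
      (1 - z • lSection a (m + 1)).det := by
  have h1 : z • cornerMatrix a m - lowerFactor a m * diffMatrix m =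
      (lowerFactor a m * diffMatrix m) * (-(1 - z • lSection a (m + 1))) := by
    rw [← lowerFactor_mul_diffMatrix_mul_lSection a m ha, neg_sub, mul_sub, mul_one,
      Matrix.mul_smul, Matrix.mul_assoc]
  have h2 : (∏ j ∈ Finset.range m, (a j - a (j + 1))) * ∏ j ∈ Finset.range m, b a j = 1 := by
    rw [← Finset.prod_mul_distrib]
    exact Finset.prod_eq_one fun j _ => sub_mul_b ha j
  have h3 : ((-1 : ℂ) ^ (m + 1)) * (-1) ^ (m + 1) = 1 := by
    rw [← mul_pow]; simp
  rw [← det_updateRow_jacobiSection, updateRow_eq a m ha, h1, Matrix.det_mul, Matrix.det_mul,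
    Matrix.det_neg, det_diffMatrix, det_lowerFactor, Fintype.card_fin]
  linear_combination (1 - z • lSection a (m + 1)).det *
    ((∏ j ∈ Finset.range m, (a j - a (j + 1))) * (∏ j ∈ Finset.range m, b a j) * h3 + h2)

/-! ### Matrix entries of the inverse operator. -/

theorem jacobiMul_zero (a x : ℕ → ℂ) : jacobiMul a x 0 = b a 0 * (x 0 - x 1) := by
  simp [jacobiMul, jacobiMatrix, Finset.sum_range_succ]
  ring

theorem jacobiMul_succ (a x : ℕ → ℂ) (k : ℕ) : jacobiMul a x (k + 1) =
    b a (k + 1) * (x (k + 1) - x (k + 2)) - b a k * (x k - x (k + 1)) := by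
  simp only [jacobiMul, LinearMap.coe_mk, AddHom.coe_mk]
  rw [Finset.sum_range_succ, Finset.sum_range_succ, Finset.sum_range_succ, Finset.sum_eq_zero]
  · have e1 : jacobiMatrix a (k + 1) k = -b a k := by
      rw [jacobiMatrix, if_neg (by omega), if_neg (by omega), if_pos rfl]
    have e2 : jacobiMatrix a (k + 1) (k + 1) = b a k + b a (k + 1) := by simp [jacobiMatrix]
    have e3 : jacobiMatrix a (k + 1) (k + 2) = -b a (k + 1) := by simp [jacobiMatrix]
    rw [e1, e2, e3]
    ring
  · intro i hi
    have := Finset.mem_range.1 hi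
    rw [jacobiMatrix, if_neg (by omega), if_neg (by omega), if_neg (by omega), zero_mul]

/-- The partial sums of a product with the Jacobi matrix telescope. -/
theorem sum_jacobiMul (a x : ℕ → ℂ) (n : ℕ) :
    ∑ k ∈ Finset.range (n + 1), jacobiMul a x k = b a n * (x n - x (n + 1)) := by
  induction n with
  | zero => simp [jacobiMul_zero]
  | succ n ih => rw [Finset.sum_range_succ, ih, jacobiMul_succ]; ring

theorem tendsto_zero_of_memlp {x : ℕ → ℂ} (hx : Memℓp x 2) : Tendsto x atTop (𝓝 0) := by
  have h1 := (hx.summable (by norm_num)).tendsto_atTop_zero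
  norm_num at h1
  have h2 := h1.sqrt
  simp only [Real.sqrt_sq (norm_nonneg _), Real.sqrt_zero] at h2
  exact tendsto_zero_iff_norm_tendsto_zero.2 h2

/-- A null sequence mapped to `e_j` by the Jacobi matrix is the `j`-th column of the
`L`-matrix. -/
theorem eq_of_jacobiMul_eq {a x : ℕ → ℂ} (hreg : IsRegularParam a) (ha : Tendsto a atTop (𝓝 0))
    (hx : Tendsto x atTop (𝓝 0)) {j : ℕ} (h : jacobiMul a x = Pi.single j 1) (i : ℕ) :
    x i = a (max i j) := by
  -- The partial sums of `e_j` are `1` once `j ≤ n` and `0` before; the telescoped identity then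
  -- determines the increments of `x`.
  have hstep (n : ℕ) : x n - x (n + 1) = if j ≤ n then a n - a (n + 1) else 0 := by
    have h1 := sum_jacobiMul a x n
    have h2 := sub_mul_b hreg n
    simp only [h, Pi.single_apply, Finset.sum_ite_eq', Finset.mem_range, Nat.lt_succ_iff] at h1
    split_ifs at h1 ⊢ with hj
    · linear_combination -(x n - x (n + 1)) * h2 - (a n - a (n + 1)) * h1
    · linear_combination -(x n - x (n + 1)) * h2 - (a n - a (n + 1)) * h1
  have hconst (n : ℕ) : x n - a (max n j) = x 0 - a (max 0 j) := by
    induction n with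
    | zero => rfl
    | succ n ih =>
      rw [← ih]
      have h1 := hstep n
      split_ifs at h1 with hj
      · rw [max_eq_left hj, max_eq_left (by omega)]
        linear_combination -h1
      · rw [max_eq_right (by omega), max_eq_right (by omega)]
        linear_combination -h1
  -- The constant difference is the limit of a difference of two null sequences, hence `0`.
  have hlim : Tendsto (fun n => x n - a (max n j)) atTop (𝓝 (0 - 0)) := by
    refine hx.sub (ha.comp ?_)
    exact tendsto_atTop_mono (fun n => le_max_left n j) tendsto_id
  simp only [hconst] at hlim
  have h0 := tendsto_nhds_unique hlim tendsto_const_nhds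
  have := hconst i
  linear_combination this - h0

/-- The graph of `L` is the graph of `J` with its coordinates swapped. -/
theorem jacobiMul_apply_of_toPMap_eq {a : ℕ → ℂ} (hreg : IsRegularParam a) {L : Ell2 →L[ℂ] Ell2}
    (hL : (L : Ell2 →ₗ[ℂ] Ell2).toPMap ⊤ = lOperator a) (y : Ell2) :
    jacobiMul a (L y : ℕ → ℂ) = (y : ℕ → ℂ) := by
  have h1 : (y, L y) ∈ ((L : Ell2 →ₗ[ℂ] Ell2).toPMap ⊤).graph :=
    (LinearPMap.mem_graph_iff _).2 ⟨⟨y, trivial⟩, rfl, rfl⟩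
  rw [hL, lOperator, LinearPMap.inverse_graph (jacobiOperator_ker a hreg)] at h1
  obtain ⟨⟨p, q⟩, hpq, he⟩ := h1
  obtain ⟨w, hw1, hw2⟩ := (LinearPMap.mem_graph_iff _).1 hpq
  obtain ⟨rfl, rfl⟩ : q = y ∧ p = L y := Prod.mk.inj he
  have h2 : ((jacobiOperator a w : Ell2) : ℕ → ℂ) = jacobiMul a ((w : Ell2) : ℕ → ℂ) := rfl
  simp only at hw1 hw2
  rw [hw1, hw2] at h2
  exact h2.symm

/-- The matrix entries of the `L`-operator. -/
theorem inner_stdVec_apply {a : ℕ → ℂ} (hreg : IsRegularParam a) (ha : Memℓp a 2)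
    {L : Ell2 →L[ℂ] Ell2} (hL : (L : Ell2 →ₗ[ℂ] Ell2).toPMap ⊤ = lOperator a) (i j : ℕ) :
    inner ℂ (stdVec i) (L (stdVec j)) = a (max i j) := by
  rw [inner_stdVec]
  refine eq_of_jacobiMul_eq hreg (tendsto_zero_of_memlp ha)
    (tendsto_zero_of_memlp (lp.memℓp _)) ?_ i
  rw [jacobiMul_apply_of_toPMap_eq hreg hL]
  ext n
  simp [stdVec]

end LMatrix

theorem mainTheorem9 (a : ℕ → ℂ) (hreg : LMatrix.IsRegularParam a) (ha : Memℓp a 2)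
    (L : LMatrix.Ell2 →L[ℂ] LMatrix.Ell2)
    (hL : (L : LMatrix.Ell2 →ₗ[ℂ] LMatrix.Ell2).toPMap ⊤ = LMatrix.lOperator a)
    (htr : LMatrix.IsTraceClass L) (z : ℂ) :
    Tendsto
      (fun n : ℕ => (-1 : ℂ) ^ n * (∏ j ∈ Finset.Icc 1 (n - 1), (a (j - 1) - a j)) *
        (a (n - 1) * (LMatrix.orthoPoly a n).eval z +
          a n * LMatrix.b a (n - 1) * (LMatrix.orthoPoly a (n - 1)).eval z))
      atTop (𝓝 (LMatrix.fredholmDet (-(z • L)))) := by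
  have h1 := LMatrix.tendsto_det_section (htr.summable_principalMinor (-z))
  rw [neg_smul] at h1
  -- Shifting to `n = m + 1` avoids the truncated `n - 1` at `n = 0`, whose term does not affect the
  -- limit.
  refine (tendsto_add_atTop_iff_nat 1).1 (((tendsto_add_atTop_iff_nat 1).2 h1).congr fun m => ?_)
  have h2 : ∏ j ∈ Finset.Icc 1 m, (a (j - 1) - a j) =
      ∏ j ∈ Finset.range m, (a j - a (j + 1)) := by
    rw [← Finset.Ico_add_one_right_eq_Icc, Finset.prod_Ico_eq_prod_range]
    simp [add_comm]
  rw [Nat.add_sub_cancel, h2, LMatrix.det_one_sub_lSection a m hreg, sub_eq_add_neg]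
  congr 2
  ext i j
  simp [LMatrix.lSection, inner_smul_right, inner_neg_right,
    LMatrix.inner_stdVec_apply hreg ha hL]
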